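/- Let $(\Theta,\lambda)$ be a probability space of types, let $u,c:\Theta\to(0,\infty)$ be $\lambda$-integrable (usage benefit and contribution cost), let $\rho>0$, and put $\nu(\theta)=u(\theta)/c(\theta)$. A screening mechanism is a triple $(R,P,Q)$ with $R,P:\Theta\to[0,1]$ measurable and $Q\in[0,1]$ such that $\rho Q=\int P\,d\lambda$ and, for all $\theta,\theta'\in\Theta$, \[R(\theta)\le Q,\qquad P(\theta)\le 1-Q,\qquad R(\theta)u(\theta)-P(\theta)c(\theta)\ge 0,\] \[R(\theta)u(\theta)-P(\theta)c(\theta)\ge R(\theta')u(\theta)-P(\theta')c(\theta).\] It is optimal if it maximizes the welfare $\int (R\,u-P\,c)\,d\lambda$ among all screening mechanisms. Theorem. There is an optimal screening mechanism $(R^*,P^*,Q^*)$ of the form \[(R^*(\theta),P^*(\theta))=\begin{cases}(Q^*,1-Q^*),&\bar\nu\le\nu(\theta),\\(\hat R,\hat P),&\underline\nu\le\nu(\theta)<\bar\nu,\\(0,0),&\nu(\theta)<\underline\nu,\end{cases}\] for some $0\le\underline\nu\le\bar\nu\le\infty$, $0\le\hat R\le Q^*$ and $0\le\hat P\le 1-Q^*$,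 where $\underline\nu$ and $\hat P$ are either both positive or both zero, and where $Q^*>0$ and $\hat R>0$ unless every screening mechanism has $Q=0$. Moreover, if $\bar\nu=\infty$ then $\hat R=Q^*$. -/

import Mathlib

open MeasureTheory

namespace CollectiveUpkeep

/-- A mechanism: usage levels `R`, contribution levels `P`, and uptime `Q`. -/
structure Mechanism (Θ : Type*) where
  R : Θ → ℝ
  P : Θ → ℝ
  Q : ℝ

/-- The valuation `ν(θ) = u(θ) / c(θ)` of an agent of type `θ`. -/
noncomputable def valuation {Θ : Type*} (u c : Θ → ℝ) (θ : Θ) : ℝ := u θ / c θ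

/-- Payoff of an agent of type `θ` from using the machine a fraction `r` of the time and
contributing a fraction `p` of the time. -/
def payoff {Θ : Type*} (u c : Θ → ℝ) (θ : Θ) (r p : ℝ) : ℝ := r * u θ - p * c θ

/-- Utilitarian welfare of a mechanism. -/
noncomputable def welfare {Θ : Type*} [MeasurableSpace Θ] (μ : Measure Θ) (u c : Θ → ℝ)
    (M : Mechanism Θ) : ℝ :=
  ∫ θ, payoff u c θ (M.R θ) (M.P θ) ∂μ

/-- The physical constraints: levels in `[0, 1]`, the balance condition and the simplex bounds. -/
structure IsPhysical {Θ : Type*} [MeasurableSpace Θ] (μ : Measure Θ) (ρ : ℝ)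
    (M : Mechanism Θ) : Prop where
  measurable_R : Measurable M.R
  measurable_P : Measurable M.P
  R_mem : ∀ θ, M.R θ ∈ Set.Icc (0 : ℝ) 1
  P_mem : ∀ θ, M.P θ ∈ Set.Icc (0 : ℝ) 1
  Q_mem : M.Q ∈ Set.Icc (0 : ℝ) 1
  balance : ρ * M.Q = ∫ θ, M.P θ ∂μ
  R_le : ∀ θ, M.R θ ≤ M.Q
  P_le : ∀ θ, M.P θ ≤ 1 - M.Q

/-- A screening mechanism satisfies the physical constraints and, for all types, the participation
and incentive-compatibility constraints. -/
structure IsScreening {Θ : Type*} [MeasurableSpace Θ] (μ : Measure Θ) (u c : Θ → ℝ) (ρ : ℝ)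
    (M : Mechanism Θ) : Prop extends IsPhysical μ ρ M where
  participation : ∀ θ, 0 ≤ payoff u c θ (M.R θ) (M.P θ)
  incentive : ∀ θ θ', payoff u c θ (M.R θ') (M.P θ') ≤ payoff u c θ (M.R θ) (M.P θ)

/-- A screening mechanism of maximal welfare among all screening mechanisms. -/
def IsOptimalScreening {Θ : Type*} [MeasurableSpace Θ] (μ : Measure Θ) (u c : Θ → ℝ) (ρ : ℝ)
    (M : Mechanism Θ) : Prop :=
  IsScreening μ u c ρ M ∧ ∀ M', IsScreening μ u c ρ M' → welfare μ u c M' ≤ welfare μ u c M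

end CollectiveUpkeep

/-! Screening mechanisms are no better than lotteries over posted offers "usage `x` against
contribution `1 - x`, take it or leave it". For a mechanism `M`, let `r(s)` and `p(s)` be the least
usage and the least contribution among menu options of total level at least `s`. Incentive
compatibility makes this increasing curve have level at least `s` (`le_envelope_level`) and makes
each type willing to buy every step of it below its own level (`envelope_step_le`). Cutting the
curve into `n` steps, each a weighted posted offer, bounds payoff and contribution pointwise up to
an error of order `1/n` (`pointwise_le_sum`). In the limit, linear inequalities between welfare,
revenue and uptime pass from posted offers to all screening mechanisms (`linear_bound`).

What remains is to maximize mean welfare over distributions on `x ∈ [0,1]` subject to a nonnegative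
mean surplus. With one constraint, two offers suffice: a best pair exists by compactness, since
surplus is upper semicontinuous, and a Lagrange multiplier (`exists_multiplier`) shows that no
screening mechanism does better. The constraint binds, as a slack one would leave room for more
weight on free access. Two offers `b ≤ a` produce three tiers: types accepting both, only `a`, or
neither. -/

namespace CollectiveUpkeep

section

variable {Θ : Type*}

/-! ### The menu of a screening mechanism -/

/-- The options offered by a mechanism whose total level `r + p` is at least `s`, including the
null option and full access. -/
def menuAbove (M : Mechanism Θ) (s : ℝ) : Set (ℝ × ℝ) :=
  {z | (z = (0, 0) ∨ z = (M.Q, 1 - M.Q) ∨ ∃ θ, z = (M.R θ, M.P θ)) ∧ s ≤ z.1 + z.2}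

/-- The infima are taken separately in the two coordinates, so the envelope point need not be an
option of the menu. For `s ≤ 1` full access keeps the set nonempty, which is what makes `sInf`
meaningful. -/
noncomputable def usageAbove (M : Mechanism Θ) (s : ℝ) : ℝ := sInf (Prod.fst '' menuAbove M s)

noncomputable def contributionAbove (M : Mechanism Θ) (s : ℝ) : ℝ :=
  sInf (Prod.snd '' menuAbove M s)

lemma top_mem_menuAbove (M : Mechanism Θ) {s : ℝ} (hs : s ≤ 1) :
    (M.Q, 1 - M.Q) ∈ menuAbove M s :=
  ⟨Or.inr (Or.inl rfl), by simpa using hs⟩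

lemma type_mem_menuAbove (M : Mechanism Θ) {s : ℝ} {θ : Θ} (hs : s ≤ M.R θ + M.P θ) :
    (M.R θ, M.P θ) ∈ menuAbove M s :=
  ⟨Or.inr (Or.inr ⟨θ, rfl⟩), hs⟩

lemma le_usageAbove {M : Mechanism Θ} {s a : ℝ} (hs : s ≤ 1) (h : ∀ z ∈ menuAbove M s, a ≤ z.1) :
    a ≤ usageAbove M s :=
  le_csInf ⟨_, _, top_mem_menuAbove M hs, rfl⟩ (by rintro _ ⟨z, hz, rfl⟩; exact h z hz)

lemma le_contributionAbove {M : Mechanism Θ} {s a : ℝ} (hs : s ≤ 1) (h : ∀ z ∈ menuAbove M s, a ≤ z.2) :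
    a ≤ contributionAbove M s :=
  le_csInf ⟨_, _, top_mem_menuAbove M hs, rfl⟩ (by rintro _ ⟨z, hz, rfl⟩; exact h z hz)

lemma menuAbove_anti {M : Mechanism Θ} {s t : ℝ} (h : s ≤ t) : menuAbove M t ⊆ menuAbove M s :=
  fun _ hz => ⟨hz.1, h.trans hz.2⟩

lemma null_mem_menuAbove (M : Mechanism Θ) {s : ℝ} (hs : s ≤ 0) : (0, 0) ∈ menuAbove M s :=
  ⟨Or.inl rfl, by simpa using hs⟩

variable [MeasurableSpace Θ] {μ : Measure Θ} {u c : Θ → ℝ} {ρ : ℝ} {M : Mechanism Θ}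

lemma IsPhysical.nonneg_of_mem_menuAbove (hM : IsPhysical μ ρ M) {s : ℝ} {z : ℝ × ℝ}
    (hz : z ∈ menuAbove M s) : 0 ≤ z.1 ∧ 0 ≤ z.2 := by
  obtain ⟨rfl | rfl | ⟨θ, rfl⟩, -⟩ := hz
  · simp
  · exact ⟨hM.Q_mem.1, by simpa using hM.Q_mem.2⟩
  · exact ⟨(hM.R_mem θ).1, (hM.P_mem θ).1⟩

lemma IsPhysical.usageAbove_le (hM : IsPhysical μ ρ M) {s : ℝ} {z : ℝ × ℝ}
    (hz : z ∈ menuAbove M s) : usageAbove M s ≤ z.1 :=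
  csInf_le ⟨0, by rintro _ ⟨y, hy, rfl⟩; exact (hM.nonneg_of_mem_menuAbove hy).1⟩ ⟨z, hz, rfl⟩

lemma IsPhysical.contributionAbove_le (hM : IsPhysical μ ρ M) {s : ℝ} {z : ℝ × ℝ}
    (hz : z ∈ menuAbove M s) : contributionAbove M s ≤ z.2 :=
  csInf_le ⟨0, by rintro _ ⟨y, hy, rfl⟩; exact (hM.nonneg_of_mem_menuAbove hy).2⟩ ⟨z, hz, rfl⟩

lemma IsPhysical.usageAbove_mono (hM : IsPhysical μ ρ M) {s t : ℝ} (h : s ≤ t) (ht : t ≤ 1) :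
    usageAbove M s ≤ usageAbove M t :=
  le_usageAbove ht fun _ hz => hM.usageAbove_le (menuAbove_anti h hz)

lemma IsPhysical.contributionAbove_mono (hM : IsPhysical μ ρ M) {s t : ℝ} (h : s ≤ t)
    (ht : t ≤ 1) : contributionAbove M s ≤ contributionAbove M t :=
  le_contributionAbove ht fun _ hz => hM.contributionAbove_le (menuAbove_anti h hz)

lemma IsPhysical.usageAbove_nonneg (hM : IsPhysical μ ρ M) {s : ℝ} (hs : s ≤ 1) :
    0 ≤ usageAbove M s :=
  le_usageAbove hs fun _ hz => (hM.nonneg_of_mem_menuAbove hz).1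

lemma IsPhysical.contributionAbove_nonneg (hM : IsPhysical μ ρ M) {s : ℝ} (hs : s ≤ 1) :
    0 ≤ contributionAbove M s :=
  le_contributionAbove hs fun _ hz => (hM.nonneg_of_mem_menuAbove hz).2

lemma IsPhysical.usageAbove_of_nonpos (hM : IsPhysical μ ρ M) {s : ℝ} (hs : s ≤ 0) :
    usageAbove M s = 0 :=
  le_antisymm (hM.usageAbove_le (null_mem_menuAbove M hs))
    (hM.usageAbove_nonneg (hs.trans zero_le_one))

lemma IsPhysical.contributionAbove_of_nonpos (hM : IsPhysical μ ρ M) {s : ℝ} (hs : s ≤ 0) :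
    contributionAbove M s = 0 :=
  le_antisymm (hM.contributionAbove_le (null_mem_menuAbove M hs))
    (hM.contributionAbove_nonneg (hs.trans zero_le_one))

lemma IsPhysical.level_le_one (hM : IsPhysical μ ρ M) (θ : Θ) : M.R θ + M.P θ ≤ 1 := by
  linarith [hM.R_le θ, hM.P_le θ]

/-- No option of the menu offers more usage for a smaller contribution than another one. -/
lemma IsScreening.le_or_le_of_mem_menuAbove (hM : IsScreening μ u c ρ M) (hu : ∀ θ, 0 < u θ)
    (hc : ∀ θ, 0 < c θ) {s : ℝ} {z w : ℝ × ℝ} (hz : z ∈ menuAbove M s) (hw : w ∈ menuAbove M s) :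
    w.1 ≤ z.1 ∨ z.2 ≤ w.2 := by
  have hP := hM.toIsPhysical
  by_contra! h
  obtain ⟨h1, h2⟩ := h
  have hw0 := hP.nonneg_of_mem_menuAbove hw
  have hwQ : w.1 ≤ M.Q := by
    obtain ⟨rfl | rfl | ⟨θ, rfl⟩, -⟩ := hw
    · exact hP.Q_mem.1
    · exact le_rfl
    · exact hP.R_le θ
  obtain ⟨hz | hz | ⟨θ, hz⟩, -⟩ := hz <;> subst hz
  · simp at h2; linarith
  · simp at h1; linarith
  -- The type choosing `z` must not prefer `w`, which offers more for less. Full access is not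
  -- covered by incentive compatibility, but it cannot cost less than `P θ`.
  · have key : w.1 * u θ - w.2 * c θ ≤ M.R θ * u θ - M.P θ * c θ := by
      obtain ⟨hw | hw | ⟨θ', hw⟩, -⟩ := hw <;> subst hw
      · simpa [payoff] using hM.participation θ
      · have := hP.P_le θ
        simp at h2
        linarith
      · exact hM.incentive θ θ'
    have := mul_lt_mul_of_pos_right h1 (hu θ)
    have := mul_lt_mul_of_pos_right h2 (hc θ)
    simp only at *
    linarith

/-- Every type weakly prefers its own option to the envelope of the menu below it. -/
lemma IsScreening.envelope_payoff_le (hM : IsScreening μ u c ρ M) (hu : ∀ θ, 0 < u θ)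
    (hc : ∀ θ, 0 < c θ) {s : ℝ} {θ : Θ} (hs : s ≤ M.R θ + M.P θ) :
    payoff u c θ (usageAbove M s) (contributionAbove M s) ≤ payoff u c θ (M.R θ) (M.P θ) := by
  have hP := hM.toIsPhysical
  have hs1 : s ≤ 1 := hs.trans (hP.level_le_one θ)
  have hr : usageAbove M s ≤ M.R θ := hP.usageAbove_le (type_mem_menuAbove M hs)
  have hmul := mul_le_mul_of_nonneg_right hr (hu θ).le
  -- Solved for the contribution, so that it suffices to bound each option. For full access, which
  -- need not be any type's choice, `P θ ≤ 1 - Q` replaces incentive compatibility.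
  have key : (usageAbove M s * u θ - payoff u c θ (M.R θ) (M.P θ)) / c θ ≤
      contributionAbove M s := by
    refine le_contributionAbove hs1 fun z hz => ?_
    rw [div_le_iff₀ (hc θ)]
    have hrz := mul_le_mul_of_nonneg_right (hP.usageAbove_le hz) (hu θ).le
    obtain ⟨hz | hz | ⟨θ', hz⟩, -⟩ := hz <;> subst hz
    · have := hM.participation θ
      simp at hrz ⊢
      linarith
    · have := mul_le_mul_of_nonneg_right (hP.P_le θ) (hc θ).le
      simp only [payoff]
      linarith
    · have := hM.incentive θ θ'
      simp only [payoff] at this ⊢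
      linarith
  rw [div_le_iff₀ (hc θ)] at key
  simp only [payoff] at key ⊢
  linarith

/-- Every type is willing to pay for each step of the envelope below its own option. -/
lemma IsScreening.envelope_step_le (hM : IsScreening μ u c ρ M) (hu : ∀ θ, 0 < u θ)
    (hc : ∀ θ, 0 < c θ) {s t : ℝ} {θ : Θ} (hst : s ≤ t) (ht : t ≤ M.R θ + M.P θ) :
    (contributionAbove M t - contributionAbove M s) * c θ ≤
      (usageAbove M t - usageAbove M s) * u θ := by
  have hP := hM.toIsPhysical
  have ht1 : t ≤ 1 := ht.trans (hP.level_le_one θ)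
  have own : (contributionAbove M t - contributionAbove M s) * c θ ≤
      (M.R θ - usageAbove M s) * u θ := by
    have h1 := hM.envelope_payoff_le hu hc (hst.trans ht)
    have h2 := mul_le_mul_of_nonneg_right
      (hP.contributionAbove_le (type_mem_menuAbove M ht)) (hc θ).le
    simp only [payoff] at h1 h2
    linarith
  -- Solved for the usage, the claim can be checked option by option. Options with usage at least `R
  -- θ` follow from `own`; the others, if not null, belong to a type `b` with less usage.
  have key : (contributionAbove M t - contributionAbove M s) * c θ / u θ + usageAbove M s ≤
      usageAbove M t := by
    refine le_usageAbove ht1 fun z hz => ?_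
    rw [← le_sub_iff_add_le, div_le_iff₀ (hu θ)]
    by_cases hRz : M.R θ ≤ z.1
    · have := mul_le_mul_of_nonneg_right hRz (hu θ).le
      linarith
    push Not at hRz
    have hrz := hP.usageAbove_le (menuAbove_anti hst hz)
    have hpz := hP.contributionAbove_le hz
    obtain ⟨hz | hz | ⟨b, hz⟩, hzt⟩ := hz <;> subst hz
    · have ht0 : t ≤ 0 := by simpa using hzt
      simp [hP.usageAbove_of_nonpos (hst.trans ht0), hP.contributionAbove_of_nonpos ht0,
        hP.contributionAbove_of_nonpos (hst.trans ht0)]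
    · exact absurd (hP.R_le θ) (not_le.2 hRz)
    · simp only at hRz hrz hpz hzt ⊢
      have hb := hM.envelope_payoff_le hu hc (hst.trans hzt)
      have i1 := hM.incentive θ b
      have i2 := hM.incentive b θ
      simp only [payoff] at hb i1 i2
      -- Single crossing: adding the two incentive constraints shows that `b` has the lower
      -- valuation. Since `b` finds the step worthwhile, so does `θ`.
      have hν : u b * c θ ≤ u θ * c b := by
        have e1 := mul_le_mul_of_nonneg_right (show (M.P θ - M.P b) * c θ ≤ _ from
          (by linarith : (M.P θ - M.P b) * c θ ≤ (M.R θ - M.R b) * u θ)) (hc b).le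
        have e2 := mul_le_mul_of_nonneg_right
          (by linarith : (M.R θ - M.R b) * u b ≤ (M.P θ - M.P b) * c b) (hc θ).le
        have : (M.R θ - M.R b) * (u b * c θ) ≤ (M.R θ - M.R b) * (u θ * c b) := by
          linarith
        exact le_of_mul_le_mul_left this (by linarith)
      have h1 : (contributionAbove M t - contributionAbove M s) * c b ≤
          (M.R b - usageAbove M s) * u b := by
        have := mul_le_mul_of_nonneg_right hpz (hc b).le
        linarith
      have h2 := mul_le_mul_of_nonneg_right h1 (hc θ).le
      have h3 := mul_le_mul_of_nonneg_left hν (sub_nonneg.2 hrz)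
      refine le_of_mul_le_mul_right ?_ (hc b)
      linarith
  rw [← le_sub_iff_add_le, div_le_iff₀ (hu θ)] at key
  exact key

/-- The envelope at level `s` has total level at least `s`. -/
lemma IsScreening.le_envelope_level (hM : IsScreening μ u c ρ M) (hu : ∀ θ, 0 < u θ)
    (hc : ∀ θ, 0 < c θ) {s : ℝ} (hs : s ≤ 1) : s ≤ usageAbove M s + contributionAbove M s := by
  -- Any two options `z`, `w` satisfy `s ≤ z.1 + w.2`, because the menu is ordered by
  -- `le_or_le_of_mem_menuAbove`. The two infima can then be taken independently.
  have : s - contributionAbove M s ≤ usageAbove M s := by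
    refine le_usageAbove hs fun z hz => ?_
    have : s - z.1 ≤ contributionAbove M s := by
      refine le_contributionAbove hs fun w hw => ?_
      have := hz.2
      have := hw.2
      rcases hM.le_or_le_of_mem_menuAbove hu hc hz hw with h | h <;> linarith
    linarith
  linarith

end

end CollectiveUpkeep

namespace CollectiveUpkeep

section

variable {Θ : Type*}

/-! ### Posted mechanisms: usage `x` against contribution `1 - x`, take it or leave it -/

/-- The types that accept usage `x` against contribution `1 - x`. -/
def takers (u c : Θ → ℝ) (x : ℝ) : Set Θ := {θ | (1 - x) * c θ ≤ x * u θ}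

variable [MeasurableSpace Θ]

noncomputable def postedWelfare (μ : Measure Θ) (u c : Θ → ℝ) (x : ℝ) : ℝ :=
  ∫ θ, max (payoff u c θ x (1 - x)) 0 ∂μ

/-- The aggregate contribution collected by the posted mechanism. -/
noncomputable def postedRevenue (μ : Measure Θ) (u c : Θ → ℝ) (x : ℝ) : ℝ :=
  (1 - x) * μ.real (takers u c x)

variable {μ : Measure Θ} {u c : Θ → ℝ} {ρ : ℝ} {M : Mechanism Θ}

lemma measurableSet_takers (hu : Measurable u) (hc : Measurable c) (x : ℝ) :
    MeasurableSet (takers u c x) :=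
  measurableSet_le (hc.const_mul _) (hu.const_mul _)

lemma integrable_payoff_const (hu : Integrable u μ) (hc : Integrable c μ) (r p : ℝ) :
    Integrable (fun θ => payoff u c θ r p) μ :=
  (hu.const_mul r).sub (hc.const_mul p)

lemma integrable_payoff_max (hu : Integrable u μ) (hc : Integrable c μ) (r p : ℝ) :
    Integrable (fun θ => max (payoff u c θ r p) 0) μ :=
  (integrable_payoff_const hu hc r p).pos_part

lemma IsPhysical.integrable_P [IsProbabilityMeasure μ] (hM : IsPhysical μ ρ M) :
    Integrable M.P μ :=
  Integrable.of_bound hM.measurable_P.aestronglyMeasurable 1 (Filter.Eventually.of_forall fun θ => by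
    rw [Real.norm_eq_abs, abs_of_nonneg (hM.P_mem θ).1]; exact (hM.P_mem θ).2)

lemma IsPhysical.integrable_payoff (hM : IsPhysical μ ρ M)
    (hu : Integrable u μ) (hc : Integrable c μ) :
    Integrable (fun θ => payoff u c θ (M.R θ) (M.P θ)) μ := by
  refine (hu.bdd_mul hM.measurable_R.aestronglyMeasurable (c := 1)
    (Filter.Eventually.of_forall fun θ => ?_)).sub
    (hc.bdd_mul hM.measurable_P.aestronglyMeasurable (c := 1)
    (Filter.Eventually.of_forall fun θ => ?_))
  · rw [Real.norm_eq_abs, abs_of_nonneg (hM.R_mem θ).1]; exact (hM.R_mem θ).2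
  · rw [Real.norm_eq_abs, abs_of_nonneg (hM.P_mem θ).1]; exact (hM.P_mem θ).2

/-- A screening mechanism is, up to `ε`, dominated by a finite mixture of posted mechanisms. -/
lemma IsScreening.pointwise_le_sum (hM : IsScreening μ u c ρ M) (hu : ∀ θ, 0 < u θ)
    (hc : ∀ θ, 0 < c θ) {A l : ℝ} (hA : 0 ≤ A) (hl : 0 ≤ l) {n : ℕ} (hn : 0 < n) :
    ∃ q x : ℕ → ℝ, (∀ j < n, 0 ≤ q j) ∧ (∀ j, x j ∈ Set.Icc (0 : ℝ) 1) ∧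
      (∑ j ∈ Finset.range n, q j * x j ≤ M.Q) ∧
      (∑ j ∈ Finset.range n, q j * (1 - x j) ≤ 1 - M.Q) ∧
      ∀ θ, A * payoff u c θ (M.R θ) (M.P θ) + l * M.P θ ≤
        ∑ j ∈ Finset.range n, q j * (A * max (payoff u c θ (x j) (1 - x j)) 0 +
          l * (1 - x j) * (takers u c (x j)).indicator 1 θ) + (A * u θ + l) / n := by
  have hP := hM.toIsPhysical
  have hn' : (0 : ℝ) < n := by exact_mod_cast hn
  set r : ℕ → ℝ := fun j => usageAbove M (j / n) with hr
  set p : ℕ → ℝ := fun j => contributionAbove M (j / n) with hp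
  set q : ℕ → ℝ := fun j => (r (j + 1) - r j) + (p (j + 1) - p j) with hq
  -- Step `j` of the envelope is `q j` times the offer `(x j, 1 - x j)`. The default `0` keeps `x j`
  -- in `[0,1]` for empty steps and for `j ≥ n`, where the envelope is not controlled.
  set x : ℕ → ℝ := fun j => if 0 < q j ∧ j < n then (r (j + 1) - r j) / q j else 0 with hx
  have hle1 : ∀ j ≤ n, (j : ℝ) / n ≤ 1 := fun j hj => by
    rw [div_le_one hn']; exact_mod_cast hj
  have hstep : ∀ j : ℕ, (j : ℝ) / n ≤ (j + 1 : ℕ) / n := fun j => by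
    gcongr; simp
  have hrm : ∀ j < n, 0 ≤ r (j + 1) - r j := fun j hj =>
    sub_nonneg.2 (hP.usageAbove_mono (hstep j) (hle1 _ hj))
  have hpm : ∀ j < n, 0 ≤ p (j + 1) - p j := fun j hj =>
    sub_nonneg.2 (hP.contributionAbove_mono (hstep j) (hle1 _ hj))
  have hqn : ∀ j < n, 0 ≤ q j := fun j hj => add_nonneg (hrm j hj) (hpm j hj)
  have hqx : ∀ j < n, q j * x j = r (j + 1) - r j := fun j hj => by
    rcases (hqn j hj).eq_or_lt with h | h
    · have h1 := hrm j hj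
      have h2 := hpm j hj
      have h3 : r (j + 1) - r j + (p (j + 1) - p j) = 0 := h.symm
      rw [← h]; linarith
    · simp only [hx, h, hj, and_self, if_true]
      field_simp
  have hqx' : ∀ j < n, q j * (1 - x j) = p (j + 1) - p j := fun j hj => by
    rw [mul_sub, hqx j hj]; simp [hq]
  have hr0 : r 0 = 0 := hP.usageAbove_of_nonpos (by simp)
  have hp0 : p 0 = 0 := hP.contributionAbove_of_nonpos (by simp)
  have hsumr : ∀ k ≤ n, ∑ j ∈ Finset.range k, q j * x j = r k := fun k hk => by
    rw [Finset.sum_congr rfl fun j hj => hqx j ((Finset.mem_range.1 hj).trans_le hk),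
      Finset.sum_range_sub, hr0, sub_zero]
  have hsump : ∀ k ≤ n, ∑ j ∈ Finset.range k, q j * (1 - x j) = p k := fun k hk => by
    rw [Finset.sum_congr rfl fun j hj => hqx' j ((Finset.mem_range.1 hj).trans_le hk),
      Finset.sum_range_sub, hp0, sub_zero]
  have hx01 : ∀ j, x j ∈ Set.Icc (0 : ℝ) 1 := fun j => by
    by_cases h : 0 < q j ∧ j < n
    · simp only [hx, h, and_self, if_true]
      refine ⟨div_nonneg (hrm j h.2) h.1.le, (div_le_one h.1).2 ?_⟩
      have := hpm j h.2
      simp only [hq]; linarith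
    · simp [hx, h]
  have htop := top_mem_menuAbove M (hle1 n le_rfl)
  refine ⟨q, x, hqn, hx01, (hsumr n le_rfl).trans_le (hP.usageAbove_le htop),
    (hsump n le_rfl).trans_le (hP.contributionAbove_le htop), fun θ => ?_⟩
  set s := M.R θ + M.P θ with hs
  have hs0 : 0 ≤ s := add_nonneg (hP.R_mem θ).1 (hP.P_mem θ).1
  have hs1 : s ≤ 1 := hP.level_le_one θ
  set k := ⌊n * s⌋₊ with hk
  have hkn : k ≤ n := Nat.floor_le_of_le (by nlinarith)
  have hks : (k : ℝ) / n ≤ s := by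
    rw [div_le_iff₀ hn', mul_comm]; exact Nat.floor_le (by positivity)
  have hsk : s ≤ k / n + 1 / n := by
    rw [← add_div, le_div_iff₀ hn', mul_comm]; exact (Nat.lt_floor_add_one _).le
  have hmem := type_mem_menuAbove M hks
  have hrk : r k ≤ M.R θ := hP.usageAbove_le hmem
  have hpk : p k ≤ M.P θ := hP.contributionAbove_le hmem
  have hlev : (k : ℝ) / n ≤ r k + p k := hM.le_envelope_level hu hc (hle1 k hkn)
  have hterm : ∀ j ∈ Finset.range k, A * (q j * x j * u θ - q j * (1 - x j) * c θ) +
      l * (q j * (1 - x j)) ≤ q j * (A * max (payoff u c θ (x j) (1 - x j)) 0 +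
          l * (1 - x j) * (takers u c (x j)).indicator 1 θ) := fun j hj => by
    have hjk := Finset.mem_range.1 hj
    have hjn := hjk.trans_le hkn
    rcases (hqn j hjn).eq_or_lt with h | h
    · rw [← h]; simp
    have htake : θ ∈ takers u c (x j) := by
      have hjs : ((j + 1 : ℕ) : ℝ) / n ≤ s := by
        refine le_trans ?_ hks
        gcongr
        exact hjk
      have := hM.envelope_step_le hu hc (hstep j) hjs
      change (p (j + 1) - p j) * _ ≤ (r (j + 1) - r j) * _ at this
      rw [← hqx j hjn, ← hqx' j hjn, mul_assoc, mul_assoc] at this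
      exact le_of_mul_le_mul_left this h
    have hmax : payoff u c θ (x j) (1 - x j) ≤ max (payoff u c θ (x j) (1 - x j)) 0 :=
      le_max_left _ _
    have := mul_le_mul_of_nonneg_left hmax (mul_nonneg h.le hA)
    simp only [Set.indicator_of_mem htake, Pi.one_apply]
    simp only [payoff] at this ⊢
    linarith
  have hnonneg : ∀ j ∈ Finset.range n, j ∉ Finset.range k →
      0 ≤ q j * (A * max (payoff u c θ (x j) (1 - x j)) 0 +
          l * (1 - x j) * (takers u c (x j)).indicator 1 θ) := fun j hj _ => by
    have h1 := hqn j (Finset.mem_range.1 hj)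
    have h2 : 0 ≤ 1 - x j := sub_nonneg.2 (hx01 j).2
    have h3 : (0 : ℝ) ≤ (takers u c (x j)).indicator 1 θ :=
      Set.indicator_nonneg (fun _ _ => zero_le_one) _
    have h4 : 0 ≤ max (payoff u c θ (x j) (1 - x j)) 0 := le_max_right _ _
    positivity
  have hsum := (Finset.sum_le_sum hterm).trans
    (Finset.sum_le_sum_of_subset_of_nonneg (Finset.range_mono hkn) hnonneg)
  rw [Finset.sum_add_distrib, ← Finset.mul_sum, ← Finset.mul_sum, Finset.sum_sub_distrib,
    ← Finset.sum_mul, ← Finset.sum_mul, hsumr k hkn, hsump k hkn] at hsum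
  -- The envelope at `k / n` lies below the option of `θ` in both coordinates and its level is short
  -- by at most `1 / n`, so each coordinate is too.
  have e1 : M.R θ ≤ r k + 1 / n := by linarith
  have e2 : M.P θ ≤ p k + 1 / n := by linarith
  have f1 := mul_le_mul_of_nonneg_right e1 (hu θ).le
  have f2 := mul_le_mul_of_nonneg_right hpk (hc θ).le
  have f3 := mul_le_mul_of_nonneg_left e2 hl
  have f4 : payoff u c θ (M.R θ) (M.P θ) ≤ r k * u θ - p k * c θ + 1 / n * u θ := by
    simp only [payoff]; linarith
  have f5 := mul_le_mul_of_nonneg_left f4 hA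
  have f6 : (A * u θ + l) / n = A * (1 / n * u θ) + l * (1 / n) := by ring
  rw [f6]
  linarith

/-- A linear bound on posted mechanisms carries over to all screening mechanisms. -/
lemma IsScreening.linear_bound [IsProbabilityMeasure μ] (hM : IsScreening μ u c ρ M)
    (hum : Measurable u) (hcm : Measurable c) (hu : ∀ θ, 0 < u θ) (hc : ∀ θ, 0 < c θ)
    (hui : Integrable u μ) (hci : Integrable c μ) {A l α β : ℝ} (hA : 0 ≤ A) (hl : 0 ≤ l)
    (hα : 0 ≤ α) (hβ : 0 ≤ β)
    (h : ∀ x ∈ Set.Icc (0 : ℝ) 1,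
      A * postedWelfare μ u c x + l * postedRevenue μ u c x ≤ α * x + β * (1 - x)) :
    A * welfare μ u c M + l * (ρ * M.Q) ≤ α * M.Q + β * (1 - M.Q) := by
  have hP := hM.toIsPhysical
  have key : ∀ n : ℕ, 0 < n → A * welfare μ u c M + l * (ρ * M.Q) ≤
      α * M.Q + β * (1 - M.Q) + (A * ∫ θ, u θ ∂μ + l) / n := fun n hn => by
    obtain ⟨q, x, hq, hx, hQ, hQ', hle⟩ := hM.pointwise_le_sum hu hc hA hl hn
    have hind : ∀ j, Integrable ((takers u c (x j)).indicator (1 : Θ → ℝ)) μ := fun j =>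
      (integrable_const (1 : ℝ)).indicator (measurableSet_takers hum hcm _)
    have hint : ∀ j, Integrable (fun θ => A * max (payoff u c θ (x j) (1 - x j)) 0 +
        l * (1 - x j) * (takers u c (x j)).indicator 1 θ) μ := fun j =>
      ((integrable_payoff_max hui hci _ _).const_mul _).add ((hind j).const_mul _)
    have hval : ∀ j, ∫ θ, (A * max (payoff u c θ (x j) (1 - x j)) 0 +
        l * (1 - x j) * (takers u c (x j)).indicator 1 θ) ∂μ =
        A * postedWelfare μ u c (x j) + l * postedRevenue μ u c (x j) := fun j => by
      rw [integral_add ((integrable_payoff_max hui hci _ _).const_mul _) ((hind j).const_mul _),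
        integral_const_mul, integral_const_mul,
        integral_indicator_one (measurableSet_takers hum hcm _), postedWelfare, postedRevenue,
        mul_assoc]
    have herr : Integrable (fun θ => (A * u θ + l) / n) μ :=
      ((hui.const_mul A).add (integrable_const l)).div_const _
    have hsum : Integrable (fun θ => ∑ j ∈ Finset.range n,
        q j * (A * max (payoff u c θ (x j) (1 - x j)) 0 +
          l * (1 - x j) * (takers u c (x j)).indicator 1 θ)) μ :=
      integrable_finsetSum _ fun j _ => (hint j).const_mul _
    have hpay := hP.integrable_payoff hui hci
    have hmono := integral_mono ((hpay.const_mul A).add (hP.integrable_P.const_mul l))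
      (hsum.add herr) hle
    simp only [Pi.add_apply] at hmono
    rw [integral_add (hpay.const_mul A) (hP.integrable_P.const_mul l), integral_const_mul,
      integral_const_mul, ← hP.balance, integral_add hsum herr,
      integral_finsetSum _ fun j _ => (hint j).const_mul _, integral_div,
      integral_add (hui.const_mul A) (integrable_const l), integral_const_mul] at hmono
    simp only [integral_const_mul, hval, integral_const, probReal_univ, one_smul] at hmono
    have hb : ∑ j ∈ Finset.range n,
        q j * (A * postedWelfare μ u c (x j) + l * postedRevenue μ u c (x j)) ≤
        ∑ j ∈ Finset.range n, (α * (q j * x j) + β * (q j * (1 - x j))) := by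
      refine Finset.sum_le_sum fun j hj => ?_
      have := mul_le_mul_of_nonneg_left (h (x j) (hx j)) (hq j (Finset.mem_range.1 hj))
      linarith
    rw [Finset.sum_add_distrib, ← Finset.mul_sum, ← Finset.mul_sum] at hb
    -- The weights add up to at most `Q` on usage and `1 - Q` on contribution; this is why `α` and
    -- `β` must be nonnegative.
    have h1 := mul_le_mul_of_nonneg_left hQ hα
    have h2 := mul_le_mul_of_nonneg_left hQ' hβ
    simp only [welfare]
    linarith
  have hlim : Filter.Tendsto (fun n : ℕ => α * M.Q + β * (1 - M.Q) +
      (A * ∫ θ, u θ ∂μ + l) / n) Filter.atTop (nhds (α * M.Q + β * (1 - M.Q) + 0)) :=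
    tendsto_const_nhds.add (tendsto_const_div_atTop_nhds_zero_nat _)
  rw [add_zero] at hlim
  refine ge_of_tendsto hlim ?_
  filter_upwards [Filter.eventually_gt_atTop 0] with n hn using key n hn

end

end CollectiveUpkeep

namespace CollectiveUpkeep

section

variable {Θ : Type*} {u c : Θ → ℝ}

/-! ### Three-tier mechanisms -/

/-- The valuation from which on types accept usage `x` against contribution `1 - x`. -/
noncomputable def cutoff (x : ℝ) : EReal := if x = 0 then ⊤ else ((1 - x) / x : ℝ)

lemma cutoff_le_valuation_iff (hc : ∀ θ, 0 < c θ) {x : ℝ} (hx : 0 ≤ x) {θ : Θ} :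
    cutoff x ≤ (valuation u c θ : EReal) ↔ θ ∈ takers u c x := by
  rcases hx.eq_or_lt with rfl | hx
  · simp [cutoff, takers, hc θ]
  · rw [cutoff, if_neg hx.ne', EReal.coe_le_coe_iff, valuation, div_le_div_iff₀ hx (hc θ),
      mul_comm (u θ)]
    rfl

lemma cutoff_anti {x y : ℝ} (hx : 0 ≤ x) (h : x ≤ y) : cutoff y ≤ cutoff x := by
  rcases hx.eq_or_lt with rfl | hx
  · simp [cutoff]
  · rw [cutoff, cutoff, if_neg hx.ne', if_neg (hx.trans_le h).ne', EReal.coe_le_coe_iff,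
      div_le_div_iff₀ (hx.trans_le h) hx]
    linarith

lemma cutoff_pos_iff {x : ℝ} (hx : 0 < x) : 0 < cutoff x ↔ x < 1 := by
  rw [cutoff, if_neg hx.ne', EReal.coe_pos, div_pos_iff_of_pos_right hx, sub_pos]

lemma cutoff_nonneg {x : ℝ} (hx : 0 ≤ x) (hx1 : x ≤ 1) : 0 ≤ cutoff x := by
  have : cutoff 1 = 0 := by simp [cutoff]
  exact this ▸ cutoff_anti hx hx1

open Classical in
/-- The mixture of two posted mechanisms. -/
noncomputable def mixtureMechanism (u c : Θ → ℝ) (q a b : ℝ) : Mechanism Θ where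
  R θ := (if θ ∈ takers u c a then q * a else 0) +
    (if θ ∈ takers u c b then (1 - q) * b else 0)
  P θ := (if θ ∈ takers u c a then q * (1 - a) else 0) +
    (if θ ∈ takers u c b then (1 - q) * (1 - b) else 0)
  Q := q * a + (1 - q) * b

/-- The two offers are accepted or declined separately, so a type gains the positive part of each.
Participation, incentive compatibility and the welfare formula rest on this. -/
lemma payoff_mixtureMechanism (q a b : ℝ) (θ : Θ) :
    payoff u c θ ((mixtureMechanism u c q a b).R θ) ((mixtureMechanism u c q a b).P θ) =
      q * max (payoff u c θ a (1 - a)) 0 + (1 - q) * max (payoff u c θ b (1 - b)) 0 := by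
  have h : ∀ x, max (payoff u c θ x (1 - x)) 0 =
      (takers u c x).indicator (fun θ => payoff u c θ x (1 - x)) θ := fun x => by
    by_cases hx : θ ∈ takers u c x
    · rw [Set.indicator_of_mem hx, max_eq_left]
      exact sub_nonneg.2 hx
    · rw [Set.indicator_of_notMem hx, max_eq_right]
      exact sub_nonpos.2 (not_le.1 (show ¬(1 - x) * c θ ≤ x * u θ from hx)).le
  rw [h, h]
  simp only [mixtureMechanism, Set.indicator, payoff]
  split_ifs <;> ring

lemma mem_takers_iff_div_le (hu : ∀ θ, 0 < u θ) (hc : ∀ θ, 0 < c θ) {x : ℝ} {θ : Θ} :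
    θ ∈ takers u c x ↔ c θ / (u θ + c θ) ≤ x := by
  rw [div_le_iff₀ (add_pos (hu θ) (hc θ))]
  change (1 - x) * c θ ≤ x * u θ ↔ _
  constructor <;> intro h <;> linarith

variable [MeasurableSpace Θ] {μ : Measure Θ} {ρ : ℝ} {M : Mechanism Θ}

/-! ### Regularity of posted mechanisms -/

lemma continuousOn_postedWelfare (hu : ∀ θ, 0 < u θ) (hc : ∀ θ, 0 < c θ)
    (hui : Integrable u μ) (hci : Integrable c μ) :
    ContinuousOn (postedWelfare μ u c) (Set.Icc 0 1) := by
  refine continuousOn_of_dominated (bound := fun θ => u θ + c θ)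
    (fun x _ => (integrable_payoff_max hui hci _ _).aestronglyMeasurable)
    (fun x hx => Filter.Eventually.of_forall fun θ => ?_) (hui.add hci)
    (Filter.Eventually.of_forall fun θ => ?_)
  · have h1 := mul_le_mul_of_nonneg_right hx.2 (hu θ).le
    have h2 := mul_nonneg (sub_nonneg.2 hx.2) (hc θ).le
    rw [Real.norm_eq_abs, abs_of_nonneg (le_max_right _ _)]
    refine max_le ?_ (add_pos (hu θ) (hc θ)).le
    simp only [payoff]
    linarith [hc θ]
  · simp only [payoff]
    fun_prop

/-- Acceptance is a threshold condition on `c / (u + c)`. Indifferent types accept, so the share of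
takers is a right-continuous distribution function, even if valuations have atoms. -/
lemma measureReal_takers_eq_cdf [IsProbabilityMeasure μ] (hum : Measurable u) (hcm : Measurable c)
    (hu : ∀ θ, 0 < u θ) (hc : ∀ θ, 0 < c θ) (x : ℝ) :
    μ.real (takers u c x) =
      ProbabilityTheory.cdf (μ.map fun θ => c θ / (u θ + c θ)) x := by
  have hm : Measurable fun θ => c θ / (u θ + c θ) := hcm.div (hum.add hcm)
  have := Measure.isProbabilityMeasure_map (μ := μ) hm.aemeasurable
  rw [ProbabilityTheory.cdf_eq_real, map_measureReal_apply hm measurableSet_Iic]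
  congr 1
  ext θ
  exact mem_takers_iff_div_le hu hc

/-- By right continuity the bound holds at some point to the right of `x`, and by monotonicity
everywhere to the left of that point. -/
lemma _root_.StieltjesFunction.upperSemicontinuous (f : StieltjesFunction ℝ) :
    UpperSemicontinuous f := by
  intro x y hy
  have h := (f.right_continuous x).eventually_lt continuousWithinAt_const hy
  have h' := h.filter_mono (nhdsWithin_mono x Set.Ioi_subset_Ici_self)
  obtain ⟨z, hz, hxz⟩ := (h'.and self_mem_nhdsWithin).exists
  filter_upwards [Iio_mem_nhds hxz] with w hw using (f.mono (le_of_lt hw)).trans_lt hz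

lemma _root_.UpperSemicontinuousOn.continuous_mul {X : Type*} [TopologicalSpace X] {s : Set X}
    {f k : X → ℝ} (hf : UpperSemicontinuousOn f s) (hk : Continuous k) (hk0 : ∀ z ∈ s, 0 ≤ k z) :
    UpperSemicontinuousOn (fun z => k z * f z) s := by
  intro z hz y hy
  obtain ⟨w, hw, hwy⟩ : ∃ w, f z < w ∧ k z * w < y := by
    have hlim : Filter.Tendsto (fun w => k z * w) (nhdsWithin (f z) (Set.Ioi (f z)))
        (nhds (k z * f z)) :=
      (Continuous.tendsto (by fun_prop) _).mono_left nhdsWithin_le_nhds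
    obtain ⟨w, h1, h2⟩ := ((hlim.eventually_lt_const hy).and self_mem_nhdsWithin).exists
    exact ⟨w, h2, h1⟩
  have h1 : ∀ᶠ z' in nhdsWithin z s, k z' * w < y :=
    (((hk.mul continuous_const).tendsto z).mono_left nhdsWithin_le_nhds).eventually_lt_const hwy
  filter_upwards [h1, hf z hz w hw, self_mem_nhdsWithin] with z' h1 h2 h3
  exact (mul_le_mul_of_nonneg_left h2.le (hk0 z' h3)).trans_lt h1

/-- The surplus of contributions over requirements of the posted mechanism with uptime `x`. -/
noncomputable def postedSurplus (μ : Measure Θ) (u c : Θ → ℝ) (ρ x : ℝ) : ℝ :=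
  postedRevenue μ u c x - ρ * x

/-- The weighted surplus is upper semicontinuous, also along a continuous change of variables. -/
lemma upperSemicontinuousOn_mul_postedSurplus [IsProbabilityMeasure μ] (hum : Measurable u)
    (hcm : Measurable c) (hu : ∀ θ, 0 < u θ) (hc : ∀ θ, 0 < c θ) {X : Type*} [TopologicalSpace X]
    {s : Set X} {f k : X → ℝ} (hf : Continuous f) (hk : Continuous k) (hf1 : ∀ z ∈ s, f z ≤ 1)
    (hk0 : ∀ z ∈ s, 0 ≤ k z) :
    UpperSemicontinuousOn (fun z => k z * postedSurplus μ u c ρ (f z)) s := by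
  have hG : UpperSemicontinuousOn (fun z => μ.real (takers u c (f z))) s := by
    simp only [measureReal_takers_eq_cdf hum hcm hu hc]
    exact ((StieltjesFunction.upperSemicontinuous _).comp hf).upperSemicontinuousOn s
  have h1 := hG.continuous_mul (k := fun z => k z * (1 - f z)) (by fun_prop)
    fun z hz => mul_nonneg (hk0 z hz) (sub_nonneg.2 (hf1 z hz))
  have h2 : UpperSemicontinuousOn (fun z => -(k z * (ρ * f z))) s :=
    (Continuous.upperSemicontinuous (by fun_prop)).upperSemicontinuousOn s
  refine cast (congrArg (UpperSemicontinuousOn · s) (funext fun z => ?_)) (h1.add h2)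
  simp only [postedSurplus, postedRevenue]
  ring

lemma postedWelfare_nonneg (x : ℝ) : 0 ≤ postedWelfare μ u c x :=
  integral_nonneg fun _ => le_max_right _ _

lemma postedWelfare_one (hu : ∀ θ, 0 < u θ) : postedWelfare μ u c 1 = ∫ θ, u θ ∂μ := by
  simp only [postedWelfare, payoff]
  refine integral_congr_ae (Filter.Eventually.of_forall fun θ => ?_)
  simpa using (hu θ).le

lemma postedWelfare_le (hu : ∀ θ, 0 < u θ) (hc : ∀ θ, 0 < c θ)
    (hui : Integrable u μ) (hci : Integrable c μ) {x : ℝ} (hx : x ∈ Set.Icc (0 : ℝ) 1) :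
    postedWelfare μ u c x ≤ x * ∫ θ, u θ ∂μ := by
  rw [← integral_const_mul]
  refine integral_mono (integrable_payoff_max hui hci _ _) (hui.const_mul x) fun θ => ?_
  have := mul_nonneg (sub_nonneg.2 hx.2) (hc θ).le
  refine max_le ?_ (mul_nonneg hx.1 (hu θ).le)
  simp only [payoff]
  linarith

lemma integral_pos_of_forall_pos [IsProbabilityMeasure μ] (hu : ∀ θ, 0 < u θ)
    (hui : Integrable u μ) : 0 < ∫ θ, u θ ∂μ := by
  rw [integral_pos_iff_support_of_nonneg (fun θ => (hu θ).le) hui]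
  have : Function.support u = Set.univ := by ext θ; simp [(hu θ).ne']
  simp [this]

lemma postedRevenue_le [IsProbabilityMeasure μ] {x : ℝ} (hx : x ≤ 1) :
    postedRevenue μ u c x ≤ 1 - x :=
  mul_le_of_le_one_right (sub_nonneg.2 hx) measureReal_le_one

lemma postedSurplus_zero (hc : ∀ θ, 0 < c θ) : postedSurplus μ u c ρ 0 = 0 := by
  have : takers u c 0 = ∅ := by ext θ; simp [takers, hc θ]
  simp [postedSurplus, postedRevenue, this]

lemma postedSurplus_one : postedSurplus μ u c ρ 1 = -ρ := by
  simp [postedSurplus, postedRevenue]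

/-! ### Feasibility -/

/-- If some screening mechanism has positive uptime, then so does some posted mechanism which
collects enough contributions. -/
lemma IsScreening.exists_postedSurplus_nonneg [IsProbabilityMeasure μ]
    (hM : IsScreening μ u c ρ M)
    (hum : Measurable u) (hcm : Measurable c) (hu : ∀ θ, 0 < u θ) (hc : ∀ θ, 0 < c θ)
    (hui : Integrable u μ) (hci : Integrable c μ) (hρ : 0 < ρ) (hQ : 0 < M.Q) :
    ∃ x, 0 < x ∧ x ≤ 1 ∧ 0 ≤ postedSurplus μ u c ρ x := by
  by_contra! hneg
  have hQ1 := hM.Q_mem.2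
  have husc : UpperSemicontinuousOn (postedSurplus μ u c ρ) (Set.Icc (M.Q / 2) 1) := by
    simpa using upperSemicontinuousOn_mul_postedSurplus (μ := μ) (ρ := ρ) hum hcm hu hc
      (s := Set.Icc (M.Q / 2) 1) continuous_id (continuous_const (y := (1 : ℝ)))
      (fun z hz => hz.2) (fun _ _ => zero_le_one)
  obtain ⟨y, hy, hmax⟩ := husc.exists_isMaxOn ⟨1, by constructor <;> linarith⟩ isCompact_Icc
  -- The surplus vanishes at `0`, so it is bounded away from `0` only on `[Q/2, 1]`. The constant
  -- `κ` places it below the line `-κ (x - Q/2)` on all of `[0,1]`; at mean uptime `Q` this line is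
  -- negative, against balance. The bound `κ ≤ ρ` keeps `α` nonnegative.
  obtain ⟨κ, hκ0, hκρ, hκ⟩ : ∃ κ, 0 < κ ∧ κ ≤ ρ ∧ κ ≤ -postedSurplus μ u c ρ y :=
    ⟨min ρ (-postedSurplus μ u c ρ y),
      lt_min hρ (neg_pos.2 (hneg y (by linarith [hy.1]) hy.2)), min_le_left _ _, min_le_right _ _⟩
  have hκQ : 0 < κ * M.Q := mul_pos hκ0 hQ
  have h := hM.linear_bound hum hcm hu hc hui hci le_rfl zero_le_one
    (α := ρ - κ + κ * (M.Q / 2)) (β := κ * (M.Q / 2)) (by linarith) (by linarith)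
    fun x hx => ?_
  · nlinarith
  suffices postedSurplus μ u c ρ x ≤ -κ * (x - M.Q / 2) by
    simp only [postedSurplus] at this
    linarith
  rcases lt_or_ge x (M.Q / 2) with hlt | hge
  · have h1 : 0 ≤ κ * (M.Q / 2 - x) := mul_nonneg hκ0.le (by linarith)
    have h2 : postedSurplus μ u c ρ x ≤ 0 := by
      rcases hx.1.eq_or_lt with h0 | h0
      · rw [← h0, postedSurplus_zero hc]
      · exact (hneg x h0 hx.2).le
    linarith
  · have h1 : postedSurplus μ u c ρ x ≤ postedSurplus μ u c ρ y := hmax ⟨hge, hx.2⟩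
    have h2 := mul_le_mul_of_nonneg_left (show x - M.Q / 2 ≤ 1 by linarith [hx.2]) hκ0.le
    linarith

/-! ### Optimal mixtures of two posted mechanisms -/

/-- `q` weighs `a` against `b`. -/
def mix (f : ℝ → ℝ) (q a b : ℝ) : ℝ := q * f a + (1 - q) * f b

/-- The mixtures of two posted mechanisms that collect enough contributions. -/
def feasibleMixtures (μ : Measure Θ) (u c : Θ → ℝ) (ρ : ℝ) : Set (ℝ × ℝ × ℝ) :=
  Set.Icc 0 1 ×ˢ Set.Icc 0 1 ×ˢ Set.Icc 0 1 ∩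
    {z | 0 ≤ mix (postedSurplus μ u c ρ) z.1 z.2.1 z.2.2}

/-- Upper semicontinuity is just what closes the condition that the surplus be nonnegative;
continuity may fail at atoms of the valuation. -/
lemma isCompact_feasibleMixtures [IsProbabilityMeasure μ] (hum : Measurable u)
    (hcm : Measurable c) (hu : ∀ θ, 0 < u θ) (hc : ∀ θ, 0 < c θ) :
    IsCompact (feasibleMixtures μ u c ρ) := by
  have h1 := upperSemicontinuousOn_mul_postedSurplus (μ := μ) (ρ := ρ) hum hcm hu hc
    (s := Set.Icc (0 : ℝ) 1 ×ˢ Set.Icc (0 : ℝ) 1 ×ˢ Set.Icc (0 : ℝ) 1)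
    (f := fun z => z.2.1) (k := fun z => z.1) (by fun_prop) (by fun_prop)
    (fun z hz => hz.2.1.2) (fun z hz => hz.1.1)
  have h2 := upperSemicontinuousOn_mul_postedSurplus (μ := μ) (ρ := ρ) hum hcm hu hc
    (s := Set.Icc (0 : ℝ) 1 ×ˢ Set.Icc (0 : ℝ) 1 ×ˢ Set.Icc (0 : ℝ) 1)
    (f := fun z => z.2.2) (k := fun z => 1 - z.1) (by fun_prop) (by fun_prop)
    (fun z hz => hz.2.2.2) (fun z hz => sub_nonneg.2 hz.1.2)
  exact (h1.add h2).isCompact_inter_preimage_Ici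
    (isCompact_Icc.prod (isCompact_Icc.prod isCompact_Icc)) 0

lemma exists_isMaxOn_feasibleMixtures [IsProbabilityMeasure μ] (hum : Measurable u)
    (hcm : Measurable c) (hu : ∀ θ, 0 < u θ) (hc : ∀ θ, 0 < c θ) (hui : Integrable u μ)
    (hci : Integrable c μ) :
    ∃ z ∈ feasibleMixtures μ u c ρ, ∀ w ∈ feasibleMixtures μ u c ρ,
      mix (postedWelfare μ u c) w.1 w.2.1 w.2.2 ≤ mix (postedWelfare μ u c) z.1 z.2.1 z.2.2 := by
  have hW := continuousOn_postedWelfare (μ := μ) hu hc hui hci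
  have hcont : ContinuousOn (fun z : ℝ × ℝ × ℝ => mix (postedWelfare μ u c) z.1 z.2.1 z.2.2)
      (feasibleMixtures μ u c ρ) := by
    refine ContinuousOn.add (ContinuousOn.mul (by fun_prop)
      (hW.comp (by fun_prop) fun z hz => hz.1.2.1)) (ContinuousOn.mul (by fun_prop)
      (hW.comp (by fun_prop) fun z hz => hz.1.2.2))
  refine (isCompact_feasibleMixtures hum hcm hu hc).exists_isMaxOn ⟨(1, 0, 0), ?_⟩ hcont
  simp [feasibleMixtures, mix, postedSurplus_zero hc]

/-- Above the value of the best feasible mixture there is a Lagrange multiplier. -/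
lemma exists_multiplier [IsProbabilityMeasure μ] (hum : Measurable u)
    (hcm : Measurable c) (hu : ∀ θ, 0 < u θ) (hc : ∀ θ, 0 < c θ) (hui : Integrable u μ)
    (hci : Integrable c μ) {V : ℝ}
    (hV : ∀ w ∈ feasibleMixtures μ u c ρ, mix (postedWelfare μ u c) w.1 w.2.1 w.2.2 < V) :
    ∃ l, 0 ≤ l ∧ ∀ x ∈ Set.Icc (0 : ℝ) 1,
      postedWelfare μ u c x + l * postedSurplus μ u c ρ x ≤ V := by
  set W := postedWelfare μ u c with hWdef
  set g := postedSurplus μ u c ρ with hg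
  have hW : ContinuousOn W (Set.Icc 0 1) := continuousOn_postedWelfare hu hc hui hci
  have hsingle : ∀ x ∈ Set.Icc (0 : ℝ) 1, V ≤ W x → g x < 0 := fun x hx hVx => by
    by_contra! h
    have := hV (1, x, x) ⟨⟨by simp, hx, hx⟩, by simpa [mix] using h⟩
    simp [mix] at this
    linarith
  set S : Set ℝ := Set.Icc 0 1 ∩ W ⁻¹' Set.Ici V with hS
  have hSc : IsCompact S :=
    (hW.upperSemicontinuousOn).isCompact_inter_preimage_Ici isCompact_Icc V
  -- Each offer with welfare at least `V` forces a lower bound on the multiplier; the least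
  -- admissible one is taken. As `V` is strictly above every feasible value, the surplus is negative
  -- on the compact set `S`, hence bounded away from `0`, and `T` is bounded.
  set T : Set ℝ := insert 0 ((fun a => (W a - V) / -g a) '' S) with hT
  have hbdd : BddAbove T := by
    rw [hT, bddAbove_insert]
    rcases S.eq_empty_or_nonempty with hE | hne
    · simp [hE]
    have husc : UpperSemicontinuousOn g S := by
      simpa using upperSemicontinuousOn_mul_postedSurplus (μ := μ) (ρ := ρ) hum hcm hu hc
        (s := S) continuous_id (continuous_const (y := (1 : ℝ)))
        (fun z hz => hz.1.2) (fun _ _ => zero_le_one)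
    obtain ⟨y, hy, hymax⟩ := husc.exists_isMaxOn hne hSc
    obtain ⟨y', hy', hymax'⟩ := hSc.exists_isMaxOn hne (hW.mono Set.inter_subset_left)
    have hgy := hsingle y hy.1 hy.2
    refine ⟨(W y' - V) / -g y, ?_⟩
    rintro _ ⟨a, ha, rfl⟩
    have h1 : W a ≤ W y' := hymax' ha
    have h2 : g a ≤ g y := hymax ha
    have h3 : V ≤ W y' := hy'.2
    exact div_le_div₀ (by linarith) (by linarith) (by linarith) (by linarith)
  have hl0 : 0 ≤ sSup T := le_csSup hbdd (Set.mem_insert _ _)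
  refine ⟨sSup T, hl0, fun x hx => ?_⟩
  rcases le_or_gt V (W x) with hVx | hVx
  · have hgx := hsingle x hx hVx
    have := le_csSup hbdd (Set.mem_insert_of_mem 0 ⟨x, ⟨hx, hVx⟩, rfl⟩)
    rw [div_le_iff₀ (by linarith)] at this
    linarith
  rcases le_or_gt (g x) 0 with hgx | hgx
  · linarith [mul_nonneg hl0 (neg_nonneg.2 hgx)]
  have hle : sSup T ≤ (V - W x) / g x := by
    refine csSup_le (Set.insert_nonempty _ _) ?_
    rintro _ (rfl | ⟨a, ha, rfl⟩)
    · exact div_nonneg (by linarith) hgx.le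
    have hga := hsingle a ha.1 ha.2
    have hd : 0 < g x - g a := by linarith
    -- The weights make the surpluses of `a` and `x` cancel. That this mixture stays below `V` says
    -- that the lower bound from `a` does not exceed the upper bound from `x`.
    have hmix := hV (g x / (g x - g a), a, x) ⟨⟨⟨by positivity, (div_le_one hd).2 (by linarith)⟩,
      ha.1, hx⟩, by
        change 0 ≤ g x / (g x - g a) * g a + (1 - g x / (g x - g a)) * g x
        apply le_of_eq
        field_simp
        ring⟩
    change g x / (g x - g a) * W a + (1 - g x / (g x - g a)) * W x < V at hmix
    have e : g x / (g x - g a) * W a + (1 - g x / (g x - g a)) * W x =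
        (g x * W a - g a * W x) / (g x - g a) := by
      field_simp
      ring
    rw [e, div_lt_iff₀ hd] at hmix
    rw [div_le_div_iff₀ (by linarith) hgx]
    linarith
  rw [le_div_iff₀ hgx] at hle
  linarith

/-- Screening mechanisms cannot beat every feasible mixture of two posted mechanisms. -/
lemma IsScreening.welfare_le_of_mixtures_le [IsProbabilityMeasure μ] (hM : IsScreening μ u c ρ M)
    (hum : Measurable u) (hcm : Measurable c) (hu : ∀ θ, 0 < u θ) (hc : ∀ θ, 0 < c θ)
    (hui : Integrable u μ) (hci : Integrable c μ) (hρ : 0 < ρ) {V : ℝ} (hV0 : 0 ≤ V)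
    (hV : ∀ w ∈ feasibleMixtures μ u c ρ, mix (postedWelfare μ u c) w.1 w.2.1 w.2.2 ≤ V) :
    welfare μ u c M ≤ V := by
  refine le_of_forall_gt_imp_ge_of_dense fun V' hV' => ?_
  obtain ⟨l, hl, h⟩ := exists_multiplier hum hcm hu hc hui hci
    fun w hw => (hV w hw).trans_lt hV'
  have hlρ := mul_nonneg hl hρ.le
  -- With these coefficients the right side is `V' + l * ρ * Q`, and the multiplier term cancels.
  have := hM.linear_bound hum hcm hu hc hui hci zero_le_one hl (α := V' + l * ρ) (β := V')
    (by linarith) (by linarith) fun x hx => by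
      have := h x hx
      simp only [postedSurplus] at this
      linarith
  linarith

/-- A best feasible mixture collects exactly the required contributions. -/
lemma mix_postedSurplus_eq_zero [IsProbabilityMeasure μ] (hum : Measurable u)
    (hcm : Measurable c) (hu : ∀ θ, 0 < u θ) (hc : ∀ θ, 0 < c θ) (hui : Integrable u μ)
    (hci : Integrable c μ) (hρ : 0 < ρ) {q a b : ℝ} (hmem : (q, a, b) ∈ feasibleMixtures μ u c ρ)
    (hmax : ∀ w ∈ feasibleMixtures μ u c ρ, mix (postedWelfare μ u c) w.1 w.2.1 w.2.2 ≤
      mix (postedWelfare μ u c) q a b) :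
    mix (postedSurplus μ u c ρ) q a b = 0 := by
  obtain ⟨⟨hq, ha, hb⟩, hsur⟩ := hmem
  simp only at hq ha hb
  refine (hsur.lt_or_eq.resolve_left fun hpos => ?_).symm
  set E := mix (postedSurplus μ u c ρ) q a b with hE
  set V := mix (postedWelfare μ u c) q a b with hV
  set U := ∫ θ, u θ ∂μ with hU
  have hU0 : 0 < U := integral_pos_of_forall_pos hu hui
  have hq' := sub_nonneg.2 hq.2
  have hgle : ∀ x ∈ Set.Icc (0 : ℝ) 1, postedSurplus μ u c ρ x ≤ 1 - x := fun x hx => by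
    have := postedRevenue_le (μ := μ) (u := u) (c := c) hx.2
    have := mul_nonneg hρ.le hx.1
    simp only [postedSurplus]; linarith
  have hEle : E ≤ 1 - (q * a + (1 - q) * b) := by
    have h1 := mul_le_mul_of_nonneg_left (hgle a ha) hq.1
    have h2 := mul_le_mul_of_nonneg_left (hgle b hb) hq'
    simp only [hE, mix]; linarith
  -- A positive surplus forces mean uptime below `1`, so welfare falls short of that of free access.
  have hVlt : V < U := by
    have h1 := mul_le_mul_of_nonneg_left (postedWelfare_le (μ := μ) hu hc hui hci ha) hq.1
    have h2 := mul_le_mul_of_nonneg_left (postedWelfare_le (μ := μ) hu hc hui hci hb) hq'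
    have h3 : V ≤ (q * a + (1 - q) * b) * U := by simp only [hV, mix]; linarith
    have h4 := mul_pos hpos hU0
    have h5 := mul_le_mul_of_nonneg_right hEle hU0.le
    linarith
  -- The multiplier bounds at the mixture and at `x = 1`, averaged with weights `ρ` and `E`,
  -- eliminate `l`. This amounts to shifting weight to free access until the surplus is used up.
  have hbound : ∀ V' > V, V + E / (E + ρ) * (U - V) ≤ V' := fun V' hV' => by
    obtain ⟨l, hl, h⟩ := exists_multiplier hum hcm hu hc hui hci
      fun w hw => (hmax w hw).trans_lt hV'
    have h1 := mul_le_mul_of_nonneg_left (h a ha) hq.1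
    have h2 := mul_le_mul_of_nonneg_left (h b hb) hq'
    have h3 := h 1 (by simp)
    rw [postedWelfare_one hu, postedSurplus_one] at h3
    have h4 : V + l * E ≤ V' := by simp only [hV, hE, mix]; linarith
    have e : V + E / (E + ρ) * (U - V) =
        (ρ * (V + l * E) + E * (U + l * -ρ)) / (E + ρ) := by
      field_simp
      ring
    rw [e, div_le_iff₀ (by linarith)]
    have := mul_le_mul_of_nonneg_left h4 hρ.le
    have := mul_le_mul_of_nonneg_left h3 hpos.le
    linarith
  have := le_of_forall_gt_imp_ge_of_dense hbound
  have : 0 < E / (E + ρ) * (U - V) := mul_pos (by positivity) (by linarith)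
  linarith

/-! ### Existence of an optimal mixture -/

lemma welfare_mixtureMechanism (hui : Integrable u μ) (hci : Integrable c μ) (q a b : ℝ) :
    welfare μ u c (mixtureMechanism u c q a b) = mix (postedWelfare μ u c) q a b := by
  simp only [welfare, payoff_mixtureMechanism, mix, postedWelfare]
  rw [integral_add ((integrable_payoff_max hui hci _ _).const_mul _)
    ((integrable_payoff_max hui hci _ _).const_mul _), integral_const_mul, integral_const_mul]

lemma isScreening_mixtureMechanism [IsProbabilityMeasure μ] (hum : Measurable u)
    (hcm : Measurable c) {q a b : ℝ} (hq : q ∈ Set.Icc (0 : ℝ) 1) (ha : a ∈ Set.Icc (0 : ℝ) 1)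
    (hb : b ∈ Set.Icc (0 : ℝ) 1) (hbal : mix (postedSurplus μ u c ρ) q a b = 0) :
    IsScreening μ u c ρ (mixtureMechanism u c q a b) := by
  have hq' := sub_nonneg.2 hq.2
  have ra := mul_nonneg hq.1 ha.1
  have pa := mul_nonneg hq.1 (sub_nonneg.2 ha.2)
  have rb := mul_nonneg hq' hb.1
  have pb := mul_nonneg hq' (sub_nonneg.2 hb.2)
  have hsa := measurableSet_takers hum hcm a
  have hsb := measurableSet_takers hum hcm b
  refine { measurable_R := ?_, measurable_P := ?_, R_mem := ?_, P_mem := ?_, Q_mem := ?_,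
           balance := ?_, R_le := ?_, P_le := ?_, participation := ?_, incentive := ?_ }
  · exact (Measurable.ite hsa measurable_const measurable_const).add
      (Measurable.ite hsb measurable_const measurable_const)
  · exact (Measurable.ite hsa measurable_const measurable_const).add
      (Measurable.ite hsb measurable_const measurable_const)
  · intro θ
    simp only [mixtureMechanism, Set.mem_Icc]
    constructor <;> split_ifs <;> linarith
  · intro θ
    simp only [mixtureMechanism, Set.mem_Icc]
    constructor <;> split_ifs <;> linarith
  · simp only [mixtureMechanism, Set.mem_Icc]
    constructor <;> linarith
  · have hP : (mixtureMechanism u c q a b).P = fun θ =>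
        q * (1 - a) * (takers u c a).indicator 1 θ +
          (1 - q) * (1 - b) * (takers u c b).indicator 1 θ := by
      funext θ
      simp [mixtureMechanism, Set.indicator]
    have hint : ∀ {s : Set Θ}, MeasurableSet s → Integrable (s.indicator (1 : Θ → ℝ)) μ :=
      fun hs => (integrable_const (1 : ℝ)).indicator hs
    rw [hP, integral_add ((hint hsa).const_mul _) ((hint hsb).const_mul _), integral_const_mul,
      integral_const_mul, integral_indicator_one hsa, integral_indicator_one hsb]
    simp only [mix, postedSurplus, postedRevenue] at hbal
    simp only [mixtureMechanism]
    linarith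
  · intro θ
    simp only [mixtureMechanism]
    split_ifs <;> linarith
  · intro θ
    simp only [mixtureMechanism]
    split_ifs <;> linarith
  · intro θ
    rw [payoff_mixtureMechanism]
    exact add_nonneg (mul_nonneg hq.1 (le_max_right _ _)) (mul_nonneg hq' (le_max_right _ _))
  · intro θ θ'
    rw [payoff_mixtureMechanism]
    have h1 := mul_le_mul_of_nonneg_left (le_max_left (payoff u c θ a (1 - a)) 0) hq.1
    have h2 := mul_le_mul_of_nonneg_left (le_max_right (payoff u c θ a (1 - a)) 0) hq.1
    have h3 := mul_le_mul_of_nonneg_left (le_max_left (payoff u c θ b (1 - b)) 0) hq'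
    have h4 := mul_le_mul_of_nonneg_left (le_max_right (payoff u c θ b (1 - b)) 0) hq'
    simp only [payoff, mixtureMechanism] at h1 h2 h3 h4 ⊢
    split_ifs <;> linarith

/-- If some screening mechanism has positive uptime, then some best feasible mixture does, with its
components ordered by uptime and a positive weight on the first one. -/
lemma exists_optimal_mixture [IsProbabilityMeasure μ] (hum : Measurable u)
    (hcm : Measurable c) (hu : ∀ θ, 0 < u θ) (hc : ∀ θ, 0 < c θ) (hui : Integrable u μ)
    (hci : Integrable c μ) (hM : ∃ x, 0 < x ∧ x ≤ 1 ∧ 0 ≤ postedSurplus μ u c ρ x) :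
    ∃ q a b, (q, a, b) ∈ feasibleMixtures μ u c ρ ∧ b ≤ a ∧ 0 < q ∧ 0 < a ∧
      ∀ w ∈ feasibleMixtures μ u c ρ, mix (postedWelfare μ u c) w.1 w.2.1 w.2.2 ≤
        mix (postedWelfare μ u c) q a b := by
  obtain ⟨⟨q, a, b⟩, hmem, hpos, hmax⟩ : ∃ z ∈ feasibleMixtures μ u c ρ,
      0 < mix id z.1 z.2.1 z.2.2 ∧ ∀ w ∈ feasibleMixtures μ u c ρ,
        mix (postedWelfare μ u c) w.1 w.2.1 w.2.2 ≤
          mix (postedWelfare μ u c) z.1 z.2.1 z.2.2 := by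
    obtain ⟨⟨q, a, b⟩, hz, hmax⟩ :=
      exists_isMaxOn_feasibleMixtures (μ := μ) (ρ := ρ) hum hcm hu hc hui hci
    obtain ⟨⟨hq, ha, hb⟩, -⟩ := id hz
    simp only at hq ha hb
    have hq' := sub_nonneg.2 hq.2
    have hU := integral_pos_of_forall_pos (μ := μ) hu hui
    have hle : mix (postedWelfare μ u c) q a b ≤ mix id q a b * ∫ θ, u θ ∂μ := by
      have h1 := mul_le_mul_of_nonneg_left (postedWelfare_le (μ := μ) hu hc hui hci ha) hq.1
      have h2 := mul_le_mul_of_nonneg_left (postedWelfare_le (μ := μ) hu hc hui hci hb) hq'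
      simp only [mix, id]; linarith
    have h0 : 0 ≤ mix id q a b := add_nonneg (mul_nonneg hq.1 ha.1) (mul_nonneg hq' hb.1)
    rcases h0.lt_or_eq with hp | hp
    · exact ⟨_, hz, hp, hmax⟩
    -- A best mixture of zero uptime has welfare at most `0`, so the feasible offer `x` is equally
    -- good.
    · obtain ⟨x, hx0, hx1, hx⟩ := hM
      refine ⟨(1, x, x), ⟨⟨by simp, ⟨hx0.le, hx1⟩, ⟨hx0.le, hx1⟩⟩, by simpa [mix] using hx⟩,
        by simpa [mix] using hx0, fun w hw => (hmax w hw).trans (hle.trans ?_)⟩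
      rw [← hp]
      simpa [mix] using postedWelfare_nonneg (μ := μ) (u := u) (c := c) x
  obtain ⟨⟨hq, ha, hb⟩, hsur⟩ := id hmem
  simp only at hq ha hb hsur hpos hmax
  have hswap : ∀ f, mix f (1 - q) b a = mix f q a b := fun f => by simp only [mix]; ring
  wlog hab : b ≤ a generalizing q a b
  · have hsur' : 0 ≤ mix (postedSurplus μ u c ρ) (1 - q) b a := by
      rw [hswap]
      exact hsur
    have hq' : 1 - q ∈ Set.Icc (0 : ℝ) 1 := ⟨by linarith [hq.2], by linarith [hq.1]⟩
    exact this (1 - q) b a ⟨⟨hq', hb, ha⟩, hsur'⟩ (by simpa only [hswap] using hpos)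
      (by simpa only [hswap] using hmax) hsur' hq' hb ha (fun f => by simp only [mix]; ring)
      (le_of_not_ge hab)
  have ha0 : 0 < a := by
    by_contra! h
    have ha0 : a = 0 := le_antisymm h ha.1
    have hb0 : b = 0 := le_antisymm (hab.trans h) hb.1
    simp [mix, ha0, hb0] at hpos
  rcases hq.1.eq_or_lt with h0 | h0
  · subst h0
    have hone : ∀ f, mix f 1 b b = mix f 0 a b := fun f => by simp [mix]
    refine ⟨1, b, b, ⟨⟨by simp, hb, hb⟩, by simpa [hone] using hsur⟩, le_rfl, one_pos, ?_, ?_⟩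
    · simpa [mix] using hpos
    · simpa only [hone] using hmax
  · exact ⟨q, a, b, hmem, hab, h0, ha0, hmax⟩

end

end CollectiveUpkeep

/-! ### The three-tier form of an optimal mechanism -/

theorem theorem2 {Θ : Type*} [MeasurableSpace Θ] (μ : Measure Θ) [IsProbabilityMeasure μ]
    (u c : Θ → ℝ) (hu_meas : Measurable u) (hc_meas : Measurable c)
    (hu_pos : ∀ θ, 0 < u θ) (hc_pos : ∀ θ, 0 < c θ)
    (hu_int : Integrable u μ) (hc_int : Integrable c μ) (ρ : ℝ) (hρ : 0 < ρ) :
    ∃ M : CollectiveUpkeep.Mechanism Θ, CollectiveUpkeep.IsOptimalScreening μ u c ρ M ∧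
      ∃ (νlo νhi : EReal) (Rhat Phat : ℝ),
        0 ≤ νlo ∧ νlo ≤ νhi ∧
        0 ≤ Rhat ∧ Rhat ≤ M.Q ∧ 0 ≤ Phat ∧ Phat ≤ 1 - M.Q ∧
        -- the three tiers
        (∀ θ, νhi ≤ (CollectiveUpkeep.valuation u c θ : EReal) →
          M.R θ = M.Q ∧ M.P θ = 1 - M.Q) ∧
        (∀ θ, νlo ≤ (CollectiveUpkeep.valuation u c θ : EReal) →
          (CollectiveUpkeep.valuation u c θ : EReal) < νhi → M.R θ = Rhat ∧ M.P θ = Phat) ∧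
        (∀ θ, (CollectiveUpkeep.valuation u c θ : EReal) < νlo → M.R θ = 0 ∧ M.P θ = 0) ∧
        -- the lower cutoff and the partial tier's contribution are both positive or both zero
        (0 < νlo ↔ 0 < Phat) ∧
        -- uptime and partial access are positive unless every screening mechanism has zero uptime
        ((∃ M' : CollectiveUpkeep.Mechanism Θ,
            CollectiveUpkeep.IsScreening μ u c ρ M' ∧ 0 < M'.Q) → 0 < M.Q ∧ 0 < Rhat) ∧
        (νhi = ⊤ → Rhat = M.Q) := by
  by_cases hex : ∃ M' : CollectiveUpkeep.Mechanism Θ,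
      CollectiveUpkeep.IsScreening μ u c ρ M' ∧ 0 < M'.Q
  · obtain ⟨M', hM', hQ'⟩ := hex
    obtain ⟨q, a, b, hmem, hba, hq0, ha0, hmax⟩ :=
      CollectiveUpkeep.exists_optimal_mixture (ρ := ρ) hu_meas hc_meas hu_pos hc_pos hu_int hc_int
        (hM'.exists_postedSurplus_nonneg hu_meas hc_meas hu_pos hc_pos hu_int hc_int hρ hQ')
    have hbal := CollectiveUpkeep.mix_postedSurplus_eq_zero hu_meas hc_meas hu_pos hc_pos hu_int
      hc_int hρ hmem hmax
    obtain ⟨⟨hq, ha, hb⟩, -⟩ := hmem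
    simp only at hq ha hb
    have hq1 := sub_nonneg.2 hq.2
    have hqa : 0 < q * a := mul_pos hq0 ha0
    have hqa' := mul_nonneg hq.1 (sub_nonneg.2 ha.2)
    have hqb := mul_nonneg hq1 hb.1
    have hqb' := mul_nonneg hq1 (sub_nonneg.2 hb.2)
    have hlo : ∀ {θ}, CollectiveUpkeep.cutoff a ≤ (CollectiveUpkeep.valuation u c θ : EReal) ↔
        θ ∈ CollectiveUpkeep.takers u c a :=
      CollectiveUpkeep.cutoff_le_valuation_iff hc_pos ha.1
    have hhi : ∀ {θ}, CollectiveUpkeep.cutoff b ≤ (CollectiveUpkeep.valuation u c θ : EReal) ↔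
        θ ∈ CollectiveUpkeep.takers u c b :=
      CollectiveUpkeep.cutoff_le_valuation_iff hc_pos hb.1
    have hcut := CollectiveUpkeep.cutoff_anti hb.1 hba
    -- As `b ≤ a`, every taker of `b` also takes `a`. The top tier takes both offers, which add up
    -- to full access; the middle tier takes only `a`, with weight `q`.
    refine ⟨CollectiveUpkeep.mixtureMechanism u c q a b,
      ⟨CollectiveUpkeep.isScreening_mixtureMechanism hu_meas hc_meas hq ha hb hbal,
        fun M hM => ?_⟩,
      CollectiveUpkeep.cutoff a, CollectiveUpkeep.cutoff b, q * a, q * (1 - a),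
      CollectiveUpkeep.cutoff_nonneg ha.1 ha.2, hcut, hqa.le, ?_, hqa', ?_, fun θ hθ => ?_,
      fun θ hθ hθ' => ?_, fun θ hθ => ?_, ?_, fun _ => ⟨?_, hqa⟩, fun htop => ?_⟩
    · rw [CollectiveUpkeep.welfare_mixtureMechanism hu_int hc_int]
      exact hM.welfare_le_of_mixtures_le hu_meas hc_meas hu_pos hc_pos hu_int hc_int hρ
        (add_nonneg (mul_nonneg hq.1 (CollectiveUpkeep.postedWelfare_nonneg a))
          (mul_nonneg hq1 (CollectiveUpkeep.postedWelfare_nonneg b))) hmax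
    · simp only [CollectiveUpkeep.mixtureMechanism]
      linarith
    · simp only [CollectiveUpkeep.mixtureMechanism]
      linarith
    · simp only [CollectiveUpkeep.mixtureMechanism, hlo.1 (hcut.trans hθ), hhi.1 hθ, if_true, true_and]
      ring
    · have hb' := mt hhi.2 (not_le.2 hθ')
      simp [CollectiveUpkeep.mixtureMechanism, hlo.1 hθ, hb']
    · have ha' := mt hlo.2 (not_le.2 hθ)
      have hb' := mt hhi.2 (not_le.2 (hθ.trans_le hcut))
      simp [CollectiveUpkeep.mixtureMechanism, ha', hb']
    · rw [CollectiveUpkeep.cutoff_pos_iff ha0, mul_pos_iff_of_pos_left hq0, sub_pos]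
    · simp only [CollectiveUpkeep.mixtureMechanism]
      linarith
    -- An infinite upper cutoff means that the second offer carries no usage, so all uptime comes
    -- from `q * a`.
    · have hb0 : b = 0 := by
        by_contra h
        rw [CollectiveUpkeep.cutoff, if_neg h] at htop
        exact EReal.coe_ne_top _ htop
      simp [CollectiveUpkeep.mixtureMechanism, hb0]
  · have hzero : ∀ M', CollectiveUpkeep.IsScreening μ u c ρ M' →
        CollectiveUpkeep.welfare μ u c M' ≤ 0 := fun M' hM' => by
      refine integral_nonpos fun θ => ?_
      have hQ : M'.Q ≤ 0 := not_lt.1 fun h => hex ⟨M', hM', h⟩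
      have h1 := mul_nonneg (hM'.P_mem θ).1 (hc_pos θ).le
      have h2 := mul_nonneg (sub_nonneg.2 ((hM'.R_le θ).trans hQ)) (hu_pos θ).le
      simp only [CollectiveUpkeep.payoff, Pi.zero_apply]
      linarith
    -- With zero uptime full access would be `(0, 1)`, so the top tier is emptied by the cutoff `⊤`
    -- and the middle tier, at `(0, 0)`, contains all types.
    refine ⟨⟨0, 0, 0⟩, ⟨⟨⟨measurable_zero, measurable_zero, by simp, by simp, by simp, by simp,
      by simp, by simp⟩, by simp [CollectiveUpkeep.payoff], by simp [CollectiveUpkeep.payoff]⟩,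
      fun M' hM' => (hzero M' hM').trans (by simp [CollectiveUpkeep.welfare,
        CollectiveUpkeep.payoff])⟩, 0, ⊤, 0, 0, le_rfl, le_top, le_rfl, le_rfl, le_rfl, by simp,
      fun θ hθ => absurd (top_le_iff.1 hθ) (EReal.coe_ne_top _), by simp, by simp, by simp,
      fun h => absurd h hex, by simp⟩
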